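/- Let $H$ be a real Hilbert space and let $F, G : H \to [0,\infty]$ be proper (not everywhere equal to $\infty$), lower semicontinuous, convex functionals such that, for some $\delta \in \mathbb{R}$, \[ F(w) - \delta \le G(w) \le F(w) + \delta \qquad \text{for all } w \in H . \] Let $u_0, v_0 \in H$ and $L \in \mathbb{R}$ be such that $|\partial F|(u_0) \le L$ and $|\partial G|(v_0) \le L$, where $|\partial F|(w) := \limsup_{z \to w,\, z \ne w} \frac{(F(w) - F(z))^+}{\|z - w\|}$ if $F(w) < \infty$ and $|\partial F|(w) := \infty$ otherwise (so in particular $L \ge 0$; likewise $\delta \ge 0$). Let $u, v : [0,\infty) \to H$ be the gradient flows of $F$ starting at $u_0$ and of $G$ starting at $v_0$, respectively. Here the gradient flow of $F$ starting at $u_0$ is the curve $u$ with $u(0) = u_0$ and $\lim_{t \downarrow 0} u(t) = u_0$ that is locally absolutely continuous on $(0,\infty)$ and satisfies $-u'(t) = \mathrm{grad}\, F(u(t))$ for almost every $t > 0$, where $\mathrm{grad}\, F(w)$ is the element of minimal norm of the subdifferential $\partial F(w) = \{ z \in H : (z, y - w) \le F(y) - F(w) \text{ for all } y \in H \}$, $F(w)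 < \infty$. Then \[ \|u(t) - v(t)\| \le \begin{cases} 4 \sqrt{\delta t} + \|u_0 - v_0\| & \text{for } 0 \le t \le \frac{\delta}{L^2}, \\[2pt] 8 \sqrt[3]{L \delta t^{2}} + \|u_0 - v_0\| & \text{for } t > \frac{\delta}{L^2}, \end{cases} \] where for $L = 0$ we read $\delta / L^2 = +\infty$, so that the first case applies to all $t \ge 0$. -/

import Mathlib

open Set Filter Topology MeasureTheory
open scoped NNReal ENNReal

/-- A functional `F : X → [0, ∞]` is proper if it is not everywhere equal to `∞`. -/
def IsProperFunctional {X : Type*} (F : X → ℝ≥0∞) : Prop :=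
  ∃ x, F x ≠ ⊤

/-- Convexity of an extended-valued functional `F : H → [0, ∞]`: for all weights `a, b ≥ 0` with
`a + b = 1`, `F (a x + b y) ≤ a F x + b F y`, where `0 * ∞ = 0`. The weights are taken in `ℝ≥0`
because `[0, ∞]` carries no scalar multiplication by negative reals. -/
def IsConvexFunctional {H : Type*} [NormedAddCommGroup H] [InnerProductSpace ℝ H]
    (F : H → ℝ≥0∞) : Prop :=
  ConvexOn ℝ≥0 univ F

/-- The subdifferential of `F` at a point `u` of its finiteness domain,
`{z | ⟪z, v - u⟫ ≤ F v - F u for all v}` (an inequality in the extended reals, whose right side is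
`∞` if `F v = ∞`). It is empty at points where `F u = ∞`. -/
def subdifferential {H : Type*} [NormedAddCommGroup H] [InnerProductSpace ℝ H]
    (F : H → ℝ≥0∞) (u : H) : Set H :=
  {z | F u ≠ ⊤ ∧ ∀ v : H, ((inner ℝ z (v - u) : ℝ) : EReal) ≤ (F v : EReal) - (F u : EReal)}

/-- `z` is the gradient of `F` at `u`: the element of minimal norm of the subdifferential. -/
def IsGradientOf {H : Type*} [NormedAddCommGroup H] [InnerProductSpace ℝ H]
    (F : H → ℝ≥0∞) (u z : H) : Prop :=
  z ∈ subdifferential F u ∧ ∀ w ∈ subdifferential F u, ‖z‖ ≤ ‖w‖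

/-- The (local, descending) slope `|∂F|(u) = limsup_{v → u} (F u - F v)⁺ / ‖v - u‖` at points of
the finiteness domain, and `∞` elsewhere. The truncated subtraction of `[0, ∞]` is the positive
part; at an isolated point the slope is `0`. -/
noncomputable def descendingSlope {H : Type*} [NormedAddCommGroup H]
    (F : H → ℝ≥0∞) (u : H) : ℝ≥0∞ :=
  open Classical in
  if F u = ⊤ then ⊤ else limsup (fun v : H => (F u - F v) / ENNReal.ofReal ‖v - u‖) (𝓝[≠] u)

/-- `u` (of which only the restriction to `[0, ∞)` matters) is the gradient flow of `F` starting at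
`u₀`: a curve with `u 0 = u₀`, continuous at `0` from the right, absolutely continuous on every
compact interval in `(0, ∞)`, and with `-u'(t) = grad F (u t)` for almost every `t > 0`. -/
structure IsGradientFlow {H : Type*} [NormedAddCommGroup H] [InnerProductSpace ℝ H]
    (F : H → ℝ≥0∞) (u₀ : H) (u : ℝ → H) : Prop where
  initial : u 0 = u₀
  tendsto_initial : Tendsto u (𝓝[>] 0) (𝓝 u₀)
  locallyAbsolutelyContinuous :
    ∀ a b : ℝ, 0 < a → a ≤ b → AbsolutelyContinuousOnInterval u a b
  flow : ∀ᵐ t : ℝ, 0 < t → ∃ z : H, IsGradientOf F (u t) z ∧ HasDerivAt u (-z) t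

/-! Subdifferentials of convex functionals are monotone; for two functionals at distance `δ` this
survives up to an error `2 δ`. Hence `‖u - v‖ ^ 2` has derivative at most `4 δ` almost everywhere,
and integrating gives `‖u t - v t‖ ≤ 2 √(δ t) + ‖u₀ - v₀‖` for all `t ≥ 0`. This is stronger than
the first bound, and for `δ < t L ^ 2` it gives the second, since there `√(δ t)` is at most the cube
root of `L δ t ^ 2`. -/

namespace AbsolutelyContinuousOnInterval

/-- The norm of an absolutely continuous function is absolutely continuous. -/
theorem norm {E : Type*} [NormedAddCommGroup E] {f : ℝ → E} {a b : ℝ}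
    (hf : AbsolutelyContinuousOnInterval f a b) :
    AbsolutelyContinuousOnInterval (fun x ↦ ‖f x‖) a b := by
  refine squeeze_zero (fun I ↦ Finset.sum_nonneg fun i _ ↦ dist_nonneg) (fun I ↦ ?_) hf
  gcongr
  exact (dist_norm_norm_le _ _).trans_eq (dist_eq_norm _ _).symm

/-- An absolutely continuous function whose derivative is almost everywhere at most `C` grows at
most linearly with rate `C`. -/
theorem sub_le_mul_of_deriv_le {f : ℝ → ℝ} {a b C : ℝ} (hab : a ≤ b)
    (hf : AbsolutelyContinuousOnInterval f a b)
    (hC : ∀ᵐ x, x ∈ Icc a b → deriv f x ≤ C) : f b - f a ≤ C * (b - a) := by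
  rw [← hf.integral_deriv_eq_sub]
  calc ∫ x in a..b, deriv f x ≤ ∫ _ in a..b, C :=
        intervalIntegral.integral_mono_ae_restrict hab hf.intervalIntegrable_deriv
          intervalIntegrable_const ((ae_restrict_iff' measurableSet_Icc).2 hC)
    _ = C * (b - a) := by rw [intervalIntegral.integral_const, smul_eq_mul, mul_comm]

end AbsolutelyContinuousOnInterval

section Perturbation

variable {H : Type*} [NormedAddCommGroup H] [InnerProductSpace ℝ H] {F G : H → ℝ≥0∞} {δ : ℝ}

theorem inner_le_toReal_sub_of_mem_subdifferential {u z v : H} (hz : z ∈ subdifferential F u)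
    (hv : F v ≠ ⊤) : inner ℝ z (v - u) ≤ (F v).toReal - (F u).toReal := by
  have h := hz.2 v
  rw [← EReal.coe_ennreal_toReal hv, ← EReal.coe_ennreal_toReal hz.1] at h
  exact_mod_cast h

theorem ne_top_and_toReal_le_of_le_add {a b : ℝ≥0∞} (ha : a ≠ ⊤)
    (h : (b : EReal) ≤ (a : EReal) + (δ : EReal)) : b ≠ ⊤ ∧ b.toReal ≤ a.toReal + δ := by
  rw [← EReal.coe_ennreal_toReal ha, ← EReal.coe_add] at h
  have hb : b ≠ ⊤ := by
    rintro rfl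
    exact EReal.coe_ne_top _ (top_le_iff.1 (by simpa only [EReal.coe_ennreal_top] using h))
  rw [← EReal.coe_ennreal_toReal hb] at h
  exact ⟨hb, by exact_mod_cast h⟩

theorem ne_top_and_toReal_le_of_sub_le {a b : ℝ≥0∞} (hb : b ≠ ⊤)
    (h : (a : EReal) - (δ : EReal) ≤ (b : EReal)) : a ≠ ⊤ ∧ a.toReal ≤ b.toReal + δ :=
  ne_top_and_toReal_le_of_le_add hb (EReal.sub_le_iff_le_add (by simp) (by simp) |>.1 h)

/-- Subgradients of two functionals at uniform distance `δ` are monotone up to `2 δ`. -/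
theorem inner_sub_sub_ge_of_mem_subdifferential
    (hFG : ∀ w : H, (F w : EReal) - (δ : EReal) ≤ (G w : EReal) ∧
      (G w : EReal) ≤ (F w : EReal) + (δ : EReal))
    {u v z w : H} (hz : z ∈ subdifferential F u) (hw : w ∈ subdifferential G v) :
    -(2 * δ) ≤ inner ℝ (u - v) (z - w) := by
  obtain ⟨hGu, hGu'⟩ := ne_top_and_toReal_le_of_le_add hz.1 (hFG u).2
  obtain ⟨hFv, hFv'⟩ := ne_top_and_toReal_le_of_sub_le hw.1 (hFG v).1
  -- Test each subgradient at the other point and add: the right sides sum to `(F v - G v) + (G u -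
  -- F u) ≤ 2 δ`.
  have h₁ := inner_le_toReal_sub_of_mem_subdifferential hz hFv
  have h₂ := inner_le_toReal_sub_of_mem_subdifferential hw hGu
  rw [← neg_sub u v, inner_neg_right] at h₁
  rw [inner_sub_right, real_inner_comm z, real_inner_comm w]
  linarith

namespace IsGradientFlow

variable {u₀ v₀ : H} {u v : ℝ → H}

/-- The derivative of the square distance is `-2 ⟪u - v, z - w⟫`, with `z`, `w` the gradients.
Absolute continuity holds only away from `0`, hence `0 < s`. -/
theorem norm_sub_sq_sub_le
    (hFG : ∀ w : H, (F w : EReal) - (δ : EReal) ≤ (G w : EReal) ∧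
      (G w : EReal) ≤ (F w : EReal) + (δ : EReal))
    (hu : IsGradientFlow F u₀ u) (hv : IsGradientFlow G v₀ v) {s t : ℝ} (hs : 0 < s)
    (hst : s ≤ t) : ‖u t - v t‖ ^ 2 - ‖u s - v s‖ ^ 2 ≤ 4 * δ * (t - s) := by
  have hac := ((hu.locallyAbsolutelyContinuous s t hs hst).sub
    (hv.locallyAbsolutelyContinuous s t hs hst)).norm
  have hac' : AbsolutelyContinuousOnInterval (fun x ↦ ‖u x - v x‖ ^ 2) s t := by
    convert hac.mul hac using 2 with x
    simp [sq]
  refine hac'.sub_le_mul_of_deriv_le hst ?_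
  filter_upwards [hu.flow, hv.flow] with x hx hy hxst
  obtain ⟨z, hz, hdu⟩ := hx (hs.trans_le hxst.1)
  obtain ⟨w, hw, hdv⟩ := hy (hs.trans_le hxst.1)
  rw [show deriv (fun x ↦ ‖u x - v x‖ ^ 2) x = _ from (hdu.sub hdv).norm_sq.deriv]
  have h := inner_sub_sub_ge_of_mem_subdifferential hFG hz.1 hw.1
  rw [show -z - -w = -(z - w) by abel, inner_neg_right]
  simp only [Pi.sub_apply]
  linarith

/-- The square distance of the gradient flows of two functionals at uniform distance `δ` grows at
most linearly with rate `4 δ`. -/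
theorem norm_sub_sq_le
    (hFG : ∀ w : H, (F w : EReal) - (δ : EReal) ≤ (G w : EReal) ∧
      (G w : EReal) ≤ (F w : EReal) + (δ : EReal))
    (hu : IsGradientFlow F u₀ u) (hv : IsGradientFlow G v₀ v) {t : ℝ} (ht : 0 ≤ t) :
    ‖u t - v t‖ ^ 2 ≤ 4 * (δ * t) + ‖u₀ - v₀‖ ^ 2 := by
  rcases ht.eq_or_lt with rfl | ht
  · simp [hu.initial, hv.initial]
  -- Let `s ↓ 0`, using right continuity of both flows at `0`.
  have hlim : Tendsto (fun s ↦ 4 * δ * (t - s) + ‖u s - v s‖ ^ 2) (𝓝[>] 0)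
      (𝓝 (4 * δ * (t - 0) + ‖u₀ - v₀‖ ^ 2)) :=
    ((tendsto_const_nhds.sub (tendsto_id.mono_left nhdsWithin_le_nhds)).const_mul _).add
      ((hu.tendsto_initial.sub hv.tendsto_initial).norm.pow 2)
  rw [sub_zero, mul_assoc] at hlim
  refine ge_of_tendsto hlim ?_
  filter_upwards [Ioc_mem_nhdsGT ht] with s hs
  linarith [norm_sub_sq_sub_le hFG hu hv hs.1 hs.2]

theorem norm_sub_le
    (hFG : ∀ w : H, (F w : EReal) - (δ : EReal) ≤ (G w : EReal) ∧
      (G w : EReal) ≤ (F w : EReal) + (δ : EReal))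
    (hu : IsGradientFlow F u₀ u) (hv : IsGradientFlow G v₀ v) (hδ : 0 ≤ δ) {t : ℝ}
    (ht : 0 ≤ t) : ‖u t - v t‖ ≤ 2 * √(δ * t) + ‖u₀ - v₀‖ := by
  -- Compare squares; the cross term on the right is nonnegative.
  refine abs_le_of_sq_le_sq' ?_ (by positivity) |>.2
  have h := Real.sq_sqrt (mul_nonneg hδ ht)
  nlinarith [norm_sub_sq_le hFG hu hv ht,
    mul_nonneg (Real.sqrt_nonneg (δ * t)) (norm_nonneg (u₀ - v₀))]

end IsGradientFlow

end Perturbation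

/-- For `δ ≤ t L ^ 2` the square root of `δ t` is at most the cube root of `L δ t ^ 2`. -/
theorem sqrt_mul_le_rpow_third {δ L t : ℝ} (hδ : 0 ≤ δ) (hL : 0 ≤ L) (ht : 0 ≤ t)
    (h : δ ≤ t * L ^ 2) : √(δ * t) ≤ (L * δ * t ^ 2) ^ ((1 : ℝ) / 3) := by
  have hs := Real.sq_sqrt (mul_nonneg hδ ht)
  rw [one_div, Real.le_rpow_inv_iff_of_pos (Real.sqrt_nonneg _) (by positivity) (by norm_num)]
  norm_cast
  -- Squaring once more removes the root; one factor `δ` of `δ ^ 3 t ^ 3` is then traded for `t L ^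
  -- 2`.
  refine abs_le_of_sq_le_sq' ?_ (by positivity) |>.2
  calc (√(δ * t) ^ 3) ^ 2 = (√(δ * t) ^ 2) ^ 3 := by ring
    _ = δ * (δ ^ 2 * t ^ 3) := by rw [hs]; ring
    _ ≤ t * L ^ 2 * (δ ^ 2 * t ^ 3) := by gcongr
    _ = (L * δ * t ^ 2) ^ 2 := by ring

theorem mainTheorem4 {H : Type*} [NormedAddCommGroup H] [InnerProductSpace ℝ H] [CompleteSpace H]
    (F G : H → ℝ≥0∞)
    (hF_proper : IsProperFunctional F) (hG_proper : IsProperFunctional G)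
    (hF_lsc : LowerSemicontinuous F) (hG_lsc : LowerSemicontinuous G)
    (hF_convex : IsConvexFunctional F) (hG_convex : IsConvexFunctional G)
    (δ L : ℝ)
    (hFG : ∀ w : H, (F w : EReal) - (δ : EReal) ≤ (G w : EReal) ∧
      (G w : EReal) ≤ (F w : EReal) + (δ : EReal))
    (u₀ v₀ : H)
    (hF_slope : (descendingSlope F u₀ : EReal) ≤ (L : EReal))
    (hG_slope : (descendingSlope G v₀ : EReal) ≤ (L : EReal))
    (u v : ℝ → H) (hu : IsGradientFlow F u₀ u) (hv : IsGradientFlow G v₀ v)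
    (t : ℝ) (ht : 0 ≤ t) :
    (t * L ^ 2 ≤ δ → ‖u t - v t‖ ≤ 4 * Real.sqrt (δ * t) + ‖u₀ - v₀‖) ∧
    (δ < t * L ^ 2 → ‖u t - v t‖ ≤ 8 * (L * δ * t ^ 2) ^ ((1 : ℝ) / 3) + ‖u₀ - v₀‖) := by
  obtain ⟨w, hw⟩ := hF_proper
  -- Where `F` is finite, `F ≤ G + δ ≤ F + 2 δ` forces `δ ≥ 0`.
  obtain ⟨hGw, h₁⟩ := ne_top_and_toReal_le_of_le_add hw (hFG w).2
  have h₂ := (ne_top_and_toReal_le_of_sub_le hGw (hFG w).1).2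
  have hδ : 0 ≤ δ := by linarith
  have hL : 0 ≤ L := by exact_mod_cast (EReal.coe_ennreal_nonneg _).trans hF_slope
  have hmain := hu.norm_sub_le hFG hv hδ ht
  refine ⟨fun _ ↦ ?_, fun h ↦ ?_⟩
  · linarith [Real.sqrt_nonneg (δ * t)]
  · linarith [sqrt_mul_le_rpow_third hδ hL ht h.le, Real.sqrt_nonneg (δ * t)]
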